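/- Consider the game of Cops and Robbers on a finite simple graph $G$. First $k$ cops choose a multiset of $k$ vertices to occupy, then the robber chooses a vertex. In each round, first every cop moves to a neighbouring vertex or stays where it is, and then the robber does likewise; both players have perfect information. The robber is captured as soon as some cop and the robber occupy the same vertex. The cop number $c(G)$ is the least $k$ for which $k$ cops can always capture the robber. The $k$-capture time $\operatorname{capt}_k(G)$ is the number of rounds that $k$ cops need to capture the robber when both sides (including the choice of starting positions) play optimally, with $\operatorname{capt}_k(G)=\infty$ if $k<c(G)$, and the cop throttling number is $$\operatorname{th}_c(G)=\min_k\{k+\operatorname{capt}_k(G)\}.$$ Theorem 2.1. Let $\alpha\in[\tfrac12,1)$ be a fixed real number. Suppose that there is a family of connected graphs $Q_n$, one of each order $n\ge 1$, with $c(Q_n)=\Omega(n^{\alpha})$; that is, there is a constant $b>0$ such that $c(Q_n)\ge b\,n^{\alpha}$ for all sufficiently large $n$. Then there are connected graphs $H_n$ on $n$ vertices, one for each $n\ge 1$, with $$\operatorname{th}_c(H_n)=\Omega\!\left(n^{1/(2-\alpha)}\right);$$ that is, there is a constant $C>0$ such that $\operatorname{th}_c(H_n)\ge C\,n^{1/(2-\alpha)}$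 for all sufficiently large $n$. -/

import Mathlib

open Filter

namespace CopsRobbers

variable {V : Type*}

/-- A legal move of one player along the graph: stay put or go to a neighbour. -/
def IsMove (G : SimpleGraph V) (u v : V) : Prop :=
  v = u ∨ G.Adj u v

/-- Some cop stands on the vertex of the robber. The (labelled) team of `k` cops at positions
`c : Fin k → V` represents a multiset of `k` vertices. -/
def Captured {k : ℕ} (c : Fin k → V) (r : V) : Prop :=
  ∃ i, c i = r

/-- `CaptureWithin G t c r`: at the beginning of a round, with the cops on `c` and the robber
on `r`, the cops can play so that, however the robber plays, the robber is captured within at most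
`t` further rounds. In a round first every cop moves (or stays), and then, if not yet captured, the
robber moves (or stays). -/
def CaptureWithin (G : SimpleGraph V) {k : ℕ} : ℕ → (Fin k → V) → V → Prop
  | 0, c, r => Captured c r
  | t + 1, c, r => Captured c r ∨
      ∃ c' : Fin k → V, (∀ i, IsMove G (c i) (c' i)) ∧
        (Captured c' r ∨ ∀ r' : V, IsMove G r r' → CaptureWithin G t c' r')

/-- The cop number `c(G)`: the least `k` for which `k` cops have initial positions such that,
for every initial position of the robber, they can capture the robber in finitely many rounds. -/
noncomputable def copNumber (G : SimpleGraph V) : ℕ :=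
  sInf {k : ℕ | ∃ c : Fin k → V, ∀ r : V, ∃ t : ℕ, CaptureWithin G t c r}

/-- The number of rounds until capture under optimal play of both sides, when the cops start on `c`
and the robber on `r`; it is `⊤` if the cops cannot force capture. -/
noncomputable def rounds (G : SimpleGraph V) {k : ℕ} (c : Fin k → V) (r : V) : ℕ∞ :=
  ⨅ (t : ℕ) (_ : CaptureWithin G t c r), (t : ℕ∞)

/-- `capt(G; S)`: the maximum number of rounds until capture over all robber placements, the cops
starting on `S`. -/
noncomputable def captureTimeFrom (G : SimpleGraph V) {k : ℕ} (c : Fin k → V) : ℕ∞ :=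
  ⨆ r : V, rounds G c r

/-- The `k`-capture time `capt_k(G)`; it is `⊤` when `k` cops cannot force capture. -/
noncomputable def captureTime (G : SimpleGraph V) (k : ℕ) : ℕ∞ :=
  ⨅ c : Fin k → V, captureTimeFrom G c

/-- The cop throttling number `th_c(G) = min_k (k + capt_k(G))`, taken over the `k` for which
`capt_k(G)` is finite. -/
noncomputable def copThrottlingNumber (G : SimpleGraph V) : ℕ :=
  sInf {m : ℕ | ∃ k : ℕ, (m : ℕ∞) = k + captureTime G k}

/-- On a finite graph the minimum defining `copThrottlingNumber` is over a nonempty set: with a cop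
on every vertex the capture time is zero. -/
theorem copThrottlingNumber_set_nonempty (G : SimpleGraph V) [Finite V] :
    {m : ℕ | ∃ k : ℕ, (m : ℕ∞) = k + captureTime G k}.Nonempty := by
  refine ⟨Nat.card V, Nat.card V, ?_⟩
  have h : captureTime G (Nat.card V) = 0 := by
    refine le_antisymm (iInf_le_of_le (Finite.equivFin V).symm (iSup_le fun r => ?_)) zero_le
    refine iInf₂_le_of_le 0 ?_ le_rfl
    exact ⟨Finite.equivFin V r, by simp⟩
  rw [h, add_zero]

/-- On a finite graph the minimum defining `copNumber` is over a nonempty set. -/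
theorem copNumber_set_nonempty (G : SimpleGraph V) [Finite V] :
    {k : ℕ | ∃ c : Fin k → V, ∀ r : V, ∃ t : ℕ, CaptureWithin G t c r}.Nonempty :=
  ⟨Nat.card V, (Finite.equivFin V).symm, fun r => ⟨0, ⟨Finite.equivFin V r, by simp⟩⟩⟩

end CopsRobbers

/-! Let `γ = 1 / (2 - α)` and `m ≈ n ^ γ`. Hang `s ≈ n / (2m)` copies of `Q = Q_m` from a central
clique by legs of `m` inner vertices. Given fewer than `s * c(Q)` cops, some branch starts with
fewer than `c(Q)` of them. The other cops need more than `m` rounds to reach its copy of `Q`, and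
retracting onto that copy turns the cops of the branch into shadows too few to win on `Q`. So either
`k` or the capture time is large (`le_copThrottlingNumber_of_retracts`). The value of `γ` balances
`(n / m) * m ^ α` against `m` (`rpow_le_div_mul_floor_rpow`). -/

namespace CopsRobbers

/-! ### Evasion inside a retract -/

section Evasion

variable {V U ι : Type*}

/-- If `G` retracts onto a copy of `Q` and the cops outside the range of `σ` are too far away to
reach that copy in `t` rounds, then the shadows of the remaining cops win on `Q`. -/
theorem captureWithin_of_retract {G : SimpleGraph V} {Q : SimpleGraph U}
    {e : U → V} {p : V → U} {d : V → ℕ}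
    (hpe : ∀ u, p (e u) = u) (hde : ∀ u, d (e u) = 0)
    (he : ∀ u v, IsMove Q u v → IsMove G (e u) (e v))
    (hp : ∀ u v, IsMove G u v → IsMove Q (p u) (p v))
    (hd : ∀ u v, IsMove G u v → d u ≤ d v + 1)
    {j k : ℕ} (σ : Fin j → Fin k) (t : ℕ) (c : Fin k → V) (u : U)
    (hfar : ∀ i, i ∉ Set.range σ → t < d (c i)) (hc : CaptureWithin G t c (e u)) :
    CaptureWithin Q t (fun l => p (c (σ l))) u := by
  -- A cop standing on `e u` has `d = 0`, so it is one of the shadowed cops.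
  have key : ∀ (c : Fin k → V) (u : U), (∀ i, i ∉ Set.range σ → 0 < d (c i)) →
      Captured c (e u) → Captured (fun l => p (c (σ l))) u := by
    rintro c u hfar ⟨i, hi⟩
    by_cases hσ : i ∈ Set.range σ
    · obtain ⟨l, rfl⟩ := hσ
      exact ⟨l, by simp only [hi, hpe]⟩
    · have := hfar i hσ
      rw [hi, hde] at this
      exact absurd this (lt_irrefl 0)
  induction t generalizing c u with
  | zero => exact key c u hfar hc
  | succ t ih =>
    rcases hc with hc | ⟨c', hmove, hc⟩
    · exact Or.inl (key c u (fun i hi => (Nat.zero_lt_succ t).trans (hfar i hi)) hc)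
    · have hfar' : ∀ i, i ∉ Set.range σ → t < d (c' i) := fun i hi => by
        have h₁ := hfar i hi
        have h₂ := hd _ _ (hmove i)
        omega
      refine Or.inr ⟨fun l => p (c' (σ l)), fun l => hp _ _ (hmove _), ?_⟩
      rcases hc with hc | hc
      · exact Or.inl (key c' u (fun i hi => (Nat.zero_le t).trans_lt (hfar' i hi)) hc)
      · exact Or.inr fun u' hu' => ih c' u' hfar' (hc _ (he _ _ hu'))

/-- If fewer than `c(Q)` cops start within distance `T` of a retract `Q` of `G`, the robber
survives more than `T` rounds. -/
theorem lt_captureTimeFrom_of_retract {G : SimpleGraph V} {Q : SimpleGraph U}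
    {e : U → V} {p : V → U} {d : V → ℕ}
    (hpe : ∀ u, p (e u) = u) (hde : ∀ u, d (e u) = 0)
    (he : ∀ u v, IsMove Q u v → IsMove G (e u) (e v))
    (hp : ∀ u v, IsMove G u v → IsMove Q (p u) (p v))
    (hd : ∀ u v, IsMove G u v → d u ≤ d v + 1)
    {k T : ℕ} (c : Fin k → V) (A : Finset (Fin k)) (hA : A.card < copNumber Q)
    (hfar : ∀ i, i ∉ A → T < d (c i)) :
    ((T + 1 : ℕ) : ℕ∞) ≤ captureTimeFrom G c := by
  have hnot := Nat.notMem_of_lt_sInf hA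
  simp only [Set.mem_ofPred_eq, not_exists, not_forall] at hnot
  obtain ⟨u, hu⟩ := hnot fun l => p (c (A.equivFin.symm l))
  refine le_iSup_of_le (e u) (le_iInf₂ fun t ht => ?_)
  rw [Nat.cast_le]
  by_contra! hlt
  refine hu t (captureWithin_of_retract hpe hde he hp hd
    (fun l => (A.equivFin.symm l : Fin k)) t c u (fun i hi => ?_) ht)
  have hiA : i ∉ A := fun h => hi ⟨A.equivFin ⟨i, h⟩, by simp⟩
  exact (Nat.le_of_lt_succ hlt).trans_lt (hfar i hiA)

/-- Throttling lower bound for a graph with many disjoint, mutually distant retracts `Q`. -/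
theorem le_copThrottlingNumber_of_retracts [Finite V] [Fintype ι] {G : SimpleGraph V}
    {Q : SimpleGraph U} {e : ι → U → V} {p : ι → V → U} {d : ι → V → ℕ} {T : ℕ}
    (hpe : ∀ i u, p i (e i u) = u) (hde : ∀ i u, d i (e i u) = 0)
    (he : ∀ i u v, IsMove Q u v → IsMove G (e i u) (e i v))
    (hp : ∀ i u v, IsMove G u v → IsMove Q (p i u) (p i v))
    (hd : ∀ i u v, IsMove G u v → d i u ≤ d i v + 1)
    (branch : V → Option ι) (hfar : ∀ i v, branch v ≠ some i → T < d i v) :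
    min (Fintype.card ι * copNumber Q) (T + 1) ≤ copThrottlingNumber G := by
  classical
  refine le_csInf (copThrottlingNumber_set_nonempty G) ?_
  rintro m ⟨k, hm⟩
  rcases lt_or_ge k (Fintype.card ι * copNumber Q) with hk | hk
  · refine (min_le_right _ _).trans ?_
    have h : ((T + 1 : ℕ) : ℕ∞) ≤ captureTime G k := by
      refine le_iInf fun c => ?_
      -- Pigeonhole over the values `some i` only: cops on `none` count for no branch and are far
      -- from every copy.
      obtain ⟨y, hy, hlt⟩ := Finset.exists_card_fiber_lt_of_card_lt_mul
        (s := (Finset.univ : Finset (Fin k)))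
        (t := (Finset.univ : Finset ι).map Function.Embedding.some)
        (f := fun j => branch (c j)) (n := copNumber Q) (by simpa using hk)
      obtain ⟨i, -, rfl⟩ := Finset.mem_map.1 hy
      exact lt_captureTimeFrom_of_retract (hpe i) (hde i) (he i) (hp i) (hd i) c _ hlt
        fun j hj => hfar i _ (by simpa using hj)
    exact_mod_cast (h.trans le_add_self).trans_eq hm.symm
  · refine (min_le_left _ _).trans (hk.trans ?_)
    exact_mod_cast (le_self_add : (k : ℕ∞) ≤ k + captureTime G k).trans_eq hm.symm

end Evasion

/-! ### The spider graph and its retractions -/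

section Spider

variable {ι U K : Type*} {ℓ : ℕ}

/-- The oriented edges of `spider`. -/
def SpiderRel (Q : SimpleGraph U) (root : U) :
    (ι × (U ⊕ Fin ℓ)) ⊕ K → (ι × (U ⊕ Fin ℓ)) ⊕ K → Prop
  | .inl (i, .inl u), .inl (i', .inl v) => i = i' ∧ Q.Adj u v
  | .inl (i, .inl u), .inl (i', .inr a) => i = i' ∧ u = root ∧ a.val = 0
  | .inl (i, .inr a), .inl (i', .inr b) => i = i' ∧ a.val + 1 = b.val
  | .inl (_, .inr a), .inr _ => a.val + 1 = ℓ
  | .inr _, .inr _ => True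
  | _, _ => False

/-- Disjoint copies of `Q`, indexed by `ι`, each joined from its vertex `root` by a path with `ℓ`
inner vertices to all vertices of a common clique `K`. -/
def spider (ι K : Type*) (ℓ : ℕ) (Q : SimpleGraph U) (root : U) :
    SimpleGraph ((ι × (U ⊕ Fin ℓ)) ⊕ K) :=
  SimpleGraph.fromRel (SpiderRel Q root)

/-- The branch of a vertex, or `none` in the central clique. -/
def spiderBranch : (ι × (U ⊕ Fin ℓ)) ⊕ K → Option ι
  | .inl (i, _) => some i
  | .inr _ => none

open Classical in
/-- The retraction of `spider` onto the copy of `Q` with index `i`. -/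
noncomputable def spiderProj (root : U) (i : ι) : (ι × (U ⊕ Fin ℓ)) ⊕ K → U
  | .inl (i', .inl u) => if i' = i then u else root
  | _ => root

open Classical in
/-- The distance to the copy of `Q` with index `i`, truncated at `ℓ + 1`. -/
noncomputable def spiderDist (i : ι) : (ι × (U ⊕ Fin ℓ)) ⊕ K → ℕ
  | .inl (i', .inl _) => if i' = i then 0 else ℓ + 1
  | .inl (i', .inr a) => if i' = i then a.val + 1 else ℓ + 1
  | .inr _ => ℓ + 1

theorem IsMove.symm {V : Type*} {G : SimpleGraph V} {u v : V} (h : IsMove G u v) :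
    IsMove G v u :=
  h.imp Eq.symm SimpleGraph.Adj.symm

theorem isMove_spider_iff {Q : SimpleGraph U} {root : U} {x y : (ι × (U ⊕ Fin ℓ)) ⊕ K} :
    IsMove (spider ι K ℓ Q root) x y ↔ y = x ∨ SpiderRel Q root x y ∨ SpiderRel Q root y x := by
  simp only [IsMove, spider, SimpleGraph.fromRel_adj]
  by_cases h : y = x
  · simp [h]
  · simp [h, Ne.symm h]

/-- A copy meets the rest of the graph only at its root, so collapsing everything outside it to
`root` turns each edge into an edge or a stay. -/
theorem isMove_spiderProj {Q : SimpleGraph U} {root : U} (i : ι)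
    {x y : (ι × (U ⊕ Fin ℓ)) ⊕ K} (h : IsMove (spider ι K ℓ Q root) x y) :
    IsMove Q (spiderProj root i x) (spiderProj root i y) := by
  have key : ∀ x y : (ι × (U ⊕ Fin ℓ)) ⊕ K, SpiderRel Q root x y →
      IsMove Q (spiderProj root i x) (spiderProj root i y) := by
    rintro (⟨i₁, u | a⟩ | a) (⟨i₂, v | b⟩ | b) h <;>
      simp only [SpiderRel, spiderProj] at h ⊢
    · obtain ⟨rfl, h⟩ := h
      split_ifs
      exacts [Or.inr h, Or.inl rfl]
    · obtain ⟨rfl, rfl, -⟩ := h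
      simp [IsMove]
    all_goals exact Or.inl rfl
  rcases isMove_spider_iff.1 h with rfl | h | h
  exacts [Or.inl rfl, key _ _ h, (key _ _ h).symm]

theorem spiderDist_le {Q : SimpleGraph U} {root : U} (i : ι)
    {x y : (ι × (U ⊕ Fin ℓ)) ⊕ K} (h : IsMove (spider ι K ℓ Q root) x y) :
    spiderDist i x ≤ spiderDist i y + 1 := by
  have key : ∀ x y : (ι × (U ⊕ Fin ℓ)) ⊕ K, SpiderRel Q root x y →
      spiderDist i x ≤ spiderDist i y + 1 ∧ spiderDist i y ≤ spiderDist i x + 1 := by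
    rintro (⟨i₁, u | a⟩ | a) (⟨i₂, v | b⟩ | b) h <;>
      simp only [SpiderRel, spiderDist] at h ⊢
    · obtain ⟨rfl, -⟩ := h
      simp
    · obtain ⟨rfl, -, h⟩ := h
      split_ifs <;> omega
    · obtain ⟨rfl, h⟩ := h
      split_ifs <;> omega
    · split_ifs <;> omega
    · simp
  rcases isMove_spider_iff.1 h with rfl | h | h
  exacts [Nat.le_succ _, (key _ _ h).1, (key _ _ h).2]

theorem lt_spiderDist (i : ι) (x : (ι × (U ⊕ Fin ℓ)) ⊕ K) (h : spiderBranch x ≠ some i) :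
    ℓ < spiderDist i x := by
  rcases x with ⟨i', u | a⟩ | a
  · have : i' ≠ i := by simpa [spiderBranch] using h
    simp [spiderDist, this]
  · have : i' ≠ i := by simpa [spiderBranch] using h
    simp [spiderDist, this]
  · simp [spiderDist]

theorem reachable_of_isMove {V : Type*} {G : SimpleGraph V} {u v : V} (h : IsMove G u v) :
    G.Reachable u v := by
  rcases h with rfl | h
  exacts [SimpleGraph.Reachable.refl _, h.reachable]

/-- Every vertex is joined to one clique vertex `z`. For `ℓ = 0` the copies would be cut off from
the clique, hence `hℓ`. -/
theorem spider_connected [Nonempty K] {Q : SimpleGraph U} (hQ : Q.Connected) (root : U)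
    (hℓ : 1 ≤ ℓ) : (spider ι K ℓ Q root).Connected := by
  obtain ⟨z⟩ := ‹Nonempty K›
  have step : ∀ {x y : (ι × (U ⊕ Fin ℓ)) ⊕ K}, SpiderRel Q root x y →
      (spider ι K ℓ Q root).Reachable x y := fun h =>
    reachable_of_isMove (isMove_spider_iff.2 (Or.inr (Or.inl h)))
  have path : ∀ (i : ι) (n : ℕ) (hn : n < ℓ), (spider ι K ℓ Q root).Reachable
      (.inl (i, .inl root)) (.inl (i, .inr ⟨n, hn⟩)) := by
    intro i n
    induction n with
    | zero => exact fun hn => step ⟨rfl, rfl, rfl⟩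
    | succ n ih => exact fun hn => (ih (by omega)).trans (step ⟨rfl, rfl⟩)
  have root_core : ∀ i : ι, (spider ι K ℓ Q root).Reachable (.inl (i, .inl root)) (.inr z) :=
    fun i => (path i (ℓ - 1) (by omega)).trans (step (Nat.sub_add_cancel hℓ))
  let emb (i : ι) : Q →g spider ι K ℓ Q root :=
    { toFun := fun u => .inl (i, .inl u)
      map_rel' := fun {u v} h => by
        refine SimpleGraph.fromRel_adj _ _ _ |>.2 ⟨fun h' => h.ne ?_, Or.inl ⟨rfl, h⟩⟩
        simpa using h' }
  have core : ∀ x : (ι × (U ⊕ Fin ℓ)) ⊕ K, (spider ι K ℓ Q root).Reachable x (.inr z) := by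
    rintro (⟨i, u | a⟩ | a)
    · exact ((hQ.preconnected u root).map (emb i)).trans (root_core i)
    · exact (path i a a.2).symm.trans (root_core i)
    · exact step trivial
  exact SimpleGraph.connected_iff_exists_forall_reachable _ |>.2 ⟨.inr z, fun x => (core x).symm⟩

/-- A connected graph on `n` vertices containing `s` mutually distant copies of `Q`. -/
theorem exists_connected_min_le_copThrottlingNumber {m s n : ℕ} (hm : 1 ≤ m)
    (hn : s * (m + m) < n) {Q : SimpleGraph (Fin m)} (hQ : Q.Connected) :
    ∃ H : SimpleGraph (Fin n), H.Connected ∧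
      min (s * copNumber Q) (m + 1) ≤ copThrottlingNumber H := by
  let root : Fin m := ⟨0, hm⟩
  -- The clique absorbs all vertices left over, so the order is exactly `n`; strictness in `hn`
  -- makes it nonempty.
  have : NeZero (n - s * (m + m)) := ⟨by omega⟩
  let K := Fin (n - s * (m + m))
  let φ : Fin n ≃ (Fin s × (Fin m ⊕ Fin m)) ⊕ K := Fintype.equivOfCardEq (by
    simp only [K, Fintype.card_sum, Fintype.card_prod, Fintype.card_fin]
    omega)
  let G := spider (Fin s) K m Q root
  have hmove : ∀ x y, IsMove (G.comap φ) x y ↔ IsMove G (φ x) (φ y) := fun x y => by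
    simp [IsMove]
  refine ⟨G.comap φ, (SimpleGraph.Iso.comap φ G).connected_iff.2 (spider_connected hQ root hm), ?_⟩
  have := le_copThrottlingNumber_of_retracts (G := G.comap φ) (Q := Q) (T := m)
    (e := fun (i : Fin s) u => φ.symm (.inl (i, .inl u)))
    (p := fun i x => spiderProj root i (φ x)) (d := fun i x => spiderDist i (φ x))
    (fun i u => by simp [spiderProj]) (fun i u => by simp [spiderDist])
    (fun i u v h => by
      rw [hmove, Equiv.apply_symm_apply, Equiv.apply_symm_apply]
      refine isMove_spider_iff.2 (h.imp ?_ fun h => Or.inl ⟨rfl, h⟩)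
      rintro rfl
      rfl)
    (fun i x y h => isMove_spiderProj i ((hmove _ _).1 h))
    (fun i x y h => spiderDist_le i ((hmove _ _).1 h))
    (fun x => spiderBranch (φ x)) (fun i x h => lt_spiderDist i (φ x) h)
  simpa using this

end Spider

end CopsRobbers

/-! ### Choice of parameters and asymptotics -/

/-- With `m = ⌊n ^ γ⌋` and `γ = 1 / (2 - α)`, about `n / m` copies of a graph with cop number of
order `m ^ α` need of order `n ^ γ` cops. -/
theorem rpow_le_div_mul_floor_rpow {α b : ℝ} (hα : α < 1) (hb : 0 ≤ b) {n : ℕ} (hn : 16 ≤ n)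
    (hsmall : (n : ℝ) ^ (1 / (2 - α)) ≤ n / 8) :
    b / 4 * (n : ℝ) ^ (1 / (2 - α)) ≤
      (((n - 1) / (⌊(n : ℝ) ^ (1 / (2 - α))⌋₊ + ⌊(n : ℝ) ^ (1 / (2 - α))⌋₊) : ℕ) : ℝ) *
        (b * (⌊(n : ℝ) ^ (1 / (2 - α))⌋₊ : ℝ) ^ α) := by
  have hγ : 0 < 1 / (2 - α) := by
    apply one_div_pos.2
    linarith
  have hn1 : (1 : ℝ) ≤ n := by exact_mod_cast (by omega : 1 ≤ n)
  have hn0 : (0 : ℝ) < n := by linarith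
  set x : ℝ := (n : ℝ) ^ (1 / (2 - α)) with hx
  have hx1 : 1 ≤ x := Real.one_le_rpow hn1 hγ.le
  set m : ℕ := ⌊x⌋₊ with hm
  have hm1 : 1 ≤ m := Nat.one_le_floor_iff x |>.2 hx1
  have hmR : (1 : ℝ) ≤ m := by exact_mod_cast hm1
  have hm0 : (0 : ℝ) < m := by linarith
  have hmx : (m : ℝ) ≤ x := Nat.floor_le (by linarith)
  set s : ℕ := (n - 1) / (m + m) with hs
  -- `n ≤ 2m(s + 1)`, and `m ≤ n / 8` lets the extra `2m` be absorbed.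
  have hsn : (n : ℝ) / (4 * m) ≤ s := by
    have h₁ : n - 1 < (m + m) * (s + 1) := Nat.lt_mul_div_succ _ (by omega)
    have h₂ : n ≤ (m + m) * (s + 1) := by omega
    have h₃ : (n : ℝ) ≤ (m + m) * (s + 1) := by exact_mod_cast h₂
    rw [div_le_iff₀ (by positivity)]
    nlinarith
  -- `γ` solves `1 + γ(α - 1) = γ`; the exponent `α - 1` is negative, so rounding `x` down to `m`
  -- only helps.
  have hpow : x ≤ n * (m : ℝ) ^ (α - 1) := by
    have h₁ : x ^ (α - 1) ≤ (m : ℝ) ^ (α - 1) :=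
      Real.rpow_le_rpow_of_nonpos hm0 hmx (by linarith)
    have h₂ : x = n * x ^ (α - 1) := by
      rw [hx, ← Real.rpow_mul hn0.le, ← Real.rpow_one_add' hn0.le]
      · congr 1
        have : 2 - α ≠ 0 := by linarith
        field_simp
        ring
      · have : (0 : ℝ) < 2 - α := by linarith
        have h : 1 + 1 / (2 - α) * (α - 1) = 1 / (2 - α) := by
          field_simp
          ring
        rw [h]
        exact hγ.ne'
    calc x = n * x ^ (α - 1) := h₂
      _ ≤ n * (m : ℝ) ^ (α - 1) := by gcongr
  calc b / 4 * x ≤ b / 4 * (n * (m : ℝ) ^ (α - 1)) := by gcongr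
    _ = n / (4 * m) * (b * (m : ℝ) ^ α) := by
      rw [Real.rpow_sub_one hm0.ne']
      field_simp
    _ ≤ s * (b * (m : ℝ) ^ α) := by gcongr

theorem theorem2p1 (α : ℝ) (hα : α ∈ Set.Ico (1 / 2 : ℝ) 1)
    (hQ : ∃ Q : (n : ℕ) → SimpleGraph (Fin n),
      (∀ n : ℕ, 1 ≤ n → (Q n).Connected) ∧
      ∃ b : ℝ, 0 < b ∧ ∀ᶠ n : ℕ in atTop,
        b * (n : ℝ) ^ α ≤ (CopsRobbers.copNumber (Q n) : ℝ)) :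
    ∃ H : (n : ℕ) → SimpleGraph (Fin n),
      (∀ n : ℕ, 1 ≤ n → (H n).Connected) ∧
      ∃ C : ℝ, 0 < C ∧ ∀ᶠ n : ℕ in atTop,
        C * (n : ℝ) ^ (1 / (2 - α)) ≤ (CopsRobbers.copThrottlingNumber (H n) : ℝ) := by
  obtain ⟨Q, hconn, b, hb, hbQ⟩ := hQ
  obtain ⟨-, hα1⟩ := hα
  have h2α : 1 < 2 - α := by linarith
  have hγ : 0 < 1 / (2 - α) := by positivity
  have hγ1 : 1 / (2 - α) < 1 := by rwa [div_lt_one (by linarith)]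
  let m (n : ℕ) : ℕ := ⌊(n : ℝ) ^ (1 / (2 - α))⌋₊
  let s (n : ℕ) : ℕ := (n - 1) / (m n + m n)
  have hm : ∀ n, 1 ≤ n → 1 ≤ m n := fun n hn =>
    (Nat.one_le_floor_iff _).2 (Real.one_le_rpow (by exact_mod_cast hn) hγ.le)
  have hex : ∀ n, ∃ H : SimpleGraph (Fin n), 1 ≤ n → H.Connected ∧
      min (s n * CopsRobbers.copNumber (Q (m n))) (m n + 1) ≤
        CopsRobbers.copThrottlingNumber H := by
    intro n
    by_cases hn : 1 ≤ n
    · have hlt : s n * (m n + m n) < n := by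
        have := Nat.div_mul_le_self (n - 1) (m n + m n)
        simp only [s]
        omega
      obtain ⟨H, hH⟩ := CopsRobbers.exists_connected_min_le_copThrottlingNumber
        (hm n hn) hlt (hconn _ (hm n hn))
      exact ⟨H, fun _ => hH⟩
    · exact ⟨⊥, fun h => absurd h hn⟩
  choose H hH using hex
  -- `b / 4` serves the bound on the number of cops, `1` the bound `m n + 1` on the time.
  refine ⟨H, fun n hn => (hH n hn).1, min (b / 4) 1, by positivity, ?_⟩
  have hmtop : Tendsto m atTop atTop :=
    tendsto_nat_floor_atTop.comp ((tendsto_rpow_atTop hγ).comp tendsto_natCast_atTop_atTop)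
  -- Since `γ < 1`, `n ^ (1 - γ)` eventually exceeds `8`.
  have hsmall : ∀ᶠ n : ℕ in atTop, (n : ℝ) ^ (1 / (2 - α)) ≤ n / 8 := by
    have h := ((tendsto_rpow_atTop (sub_pos.2 hγ1)).comp
      tendsto_natCast_atTop_atTop).eventually_ge_atTop 8
    filter_upwards [h, eventually_gt_atTop 0] with n hn hn0
    have hn0' : (0 : ℝ) < n := by exact_mod_cast hn0
    simp only [Function.comp_apply, Real.rpow_sub hn0', Real.rpow_one] at hn
    rw [le_div_iff₀ (by positivity)] at hn
    linarith
  filter_upwards [hmtop.eventually hbQ, hsmall, eventually_ge_atTop 16] with n hQn hn8 hn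
  have hx0 : 0 ≤ (n : ℝ) ^ (1 / (2 - α)) := by positivity
  have hle : ((min (s n * CopsRobbers.copNumber (Q (m n))) (m n + 1) : ℕ) : ℝ) ≤
      CopsRobbers.copThrottlingNumber (H n) := by
    exact_mod_cast (hH n (by omega)).2
  refine le_trans ?_ hle
  rw [Nat.cast_min, le_min_iff]
  constructor
  · calc min (b / 4) 1 * (n : ℝ) ^ (1 / (2 - α)) ≤ b / 4 * (n : ℝ) ^ (1 / (2 - α)) := by
          gcongr
          exact min_le_left _ _
      _ ≤ s n * (b * (m n : ℝ) ^ α) := rpow_le_div_mul_floor_rpow hα1 hb.le hn hn8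
      _ ≤ s n * CopsRobbers.copNumber (Q (m n)) := by gcongr
      _ = _ := by push_cast; rfl
  · calc min (b / 4) 1 * (n : ℝ) ^ (1 / (2 - α)) ≤ 1 * (n : ℝ) ^ (1 / (2 - α)) := by
          gcongr
          exact min_le_right _ _
      _ ≤ _ := by
        rw [one_mul]
        push_cast
        exact (Nat.lt_floor_add_one _).le
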